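/- Let $\phi(x,y,\theta)$ be a holomorphic quadratic form on $\mathbf{C}^n_x\times\mathbf{C}^n_y\times\mathbf{C}^N_\theta$ which is a nondegenerate phase function: the differentials $d(\partial\phi/\partial\theta_1),\dots,d(\partial\phi/\partial\theta_N)$ are linearly independent over $\mathbf{C}$. Let $C_\phi=\{(x,y,\theta):\ \phi'_\theta(x,y,\theta)=0\}$, and suppose that $\phi$ generates a complex linear canonical transformation $\kappa:\mathbf{C}^{2n}\to\mathbf{C}^{2n}$, i.e. that $$\{(x,\phi'_x(x,y,\theta);\,y,-\phi'_y(x,y,\theta)):\ (x,y,\theta)\in C_\phi\}$$ is the graph $\{(x,\xi;y,\eta):\ (x,\xi)=\kappa(y,\eta)\}$ of a bijective complex linear map $\kappa:(y,\eta)\mapsto(x,\xi)$. For a real quadratic form $\Phi$ on $\mathbf{C}^n$ (viewed as a real vector space) put $$\Lambda_\Phi=\Big\{\Big(x,\tfrac{2}{i}\tfrac{\partial\Phi}{\partial x}(x)\Big):\ x\in\mathbf{C}^n\Big\}\subset\mathbf{C}^{2n}.$$ Let $\Phi_0,\Phi_1$ be real quadratic forms on $\mathbf{C}^n$ which are strictly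 plurisubharmonic, i.e. whose Levi matrices $\big(\partial_{\bar z_j}\partial_{z_k}\Phi_\nu\big)_{j,k}$, $\nu=0,1$, are positive definite, and assume that $\kappa(\Lambda_{\Phi_0})=\Lambda_{\Phi_1}$. Then the real quadratic form $$(y,\theta)\mapsto \Phi_0(y)-\operatorname{Im}\phi(0,y,\theta)$$ on $\mathbf{C}^n\times\mathbf{C}^N$ (a real vector space of dimension $2n+2N$) has signature $(n+N,n+N)$: the maximal real dimension of a subspace on which it is positive definite is $n+N$, and likewise for negative definite. -/

import Mathlib

open scoped ComplexOrder

noncomputable section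

/-! ### Wirtinger derivatives, the Levi matrix and `Λ_Φ` -/

/-- The Wirtinger derivative `∂f/∂z_k = (∂f/∂(Re z_k) - i ∂f/∂(Im z_k)) / 2`. -/
def dz {n : ℕ} (k : Fin n) (f : (Fin n → ℂ) → ℂ) (z : Fin n → ℂ) : ℂ :=
  (lineDeriv ℝ f z (Pi.single k 1) - Complex.I * lineDeriv ℝ f z (Pi.single k Complex.I)) / 2

/-- The Wirtinger derivative `∂f/∂z̄_k = (∂f/∂(Re z_k) + i ∂f/∂(Im z_k)) / 2`. -/
def dzbar {n : ℕ} (k : Fin n) (f : (Fin n → ℂ) → ℂ) (z : Fin n → ℂ) : ℂ :=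
  (lineDeriv ℝ f z (Pi.single k 1) + Complex.I * lineDeriv ℝ f z (Pi.single k Complex.I)) / 2

/-- The Levi matrix `(∂²Φ/∂z̄_j∂z_k)_{j,k}` of a real function `Φ` on `ℂⁿ`, at the point `z`. -/
def leviMatrix {n : ℕ} (Φ : (Fin n → ℂ) → ℝ) (z : Fin n → ℂ) : Matrix (Fin n) (Fin n) ℂ :=
  Matrix.of fun j k => dzbar j (dz k fun w => (Φ w : ℂ)) z

/-- A real quadratic form on `ℂⁿ` is strictly plurisubharmonic if its Levi matrix, which does not
depend on the point, is positive definite. -/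
def IsStrictlyPlurisubharmonic {n : ℕ} (Φ : QuadraticForm ℝ (Fin n → ℂ)) : Prop :=
  ∀ z, (leviMatrix Φ z).PosDef

/-- `Λ_Φ = {(x, (2/i) ∂Φ/∂x (x)) : x ∈ ℂⁿ}`, a subset of `ℂⁿ × ℂⁿ`. -/
def weightGraph {n : ℕ} (Φ : QuadraticForm ℝ (Fin n → ℂ)) : Set ((Fin n → ℂ) × (Fin n → ℂ)) :=
  Set.range fun x => (x, fun k => 2 / Complex.I * dz k (fun w => (Φ w : ℂ)) x)

/-! ### Phase functions

A phase is a holomorphic quadratic form `φ (x, y, θ)` on `ℂⁿ × ℂⁿ × ℂᴺ`. -/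

/-- The (complex) gradient `φ'_x`. -/
def phaseDx {n N : ℕ} (φ : QuadraticForm ℂ ((Fin n → ℂ) × (Fin n → ℂ) × (Fin N → ℂ)))
    (p : (Fin n → ℂ) × (Fin n → ℂ) × (Fin N → ℂ)) : Fin n → ℂ :=
  fun k => lineDeriv ℂ φ p (Pi.single k 1, 0, 0)

/-- The (complex) gradient `φ'_y`. -/
def phaseDy {n N : ℕ} (φ : QuadraticForm ℂ ((Fin n → ℂ) × (Fin n → ℂ) × (Fin N → ℂ)))
    (p : (Fin n → ℂ) × (Fin n → ℂ) × (Fin N → ℂ)) : Fin n → ℂ :=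
  fun k => lineDeriv ℂ φ p (0, Pi.single k 1, 0)

/-- The (complex) gradient `φ'_θ`. -/
def phaseDθ {n N : ℕ} (φ : QuadraticForm ℂ ((Fin n → ℂ) × (Fin n → ℂ) × (Fin N → ℂ)))
    (p : (Fin n → ℂ) × (Fin n → ℂ) × (Fin N → ℂ)) : Fin N → ℂ :=
  fun j => lineDeriv ℂ φ p (0, 0, Pi.single j 1)

/-- The critical set `C_φ = {φ'_θ = 0}`. -/
def criticalSet {n N : ℕ} (φ : QuadraticForm ℂ ((Fin n → ℂ) × (Fin n → ℂ) × (Fin N → ℂ))) :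
    Set ((Fin n → ℂ) × (Fin n → ℂ) × (Fin N → ℂ)) :=
  {p | phaseDθ φ p = 0}

/-- `φ` is a nondegenerate phase function: the differentials `d(∂φ/∂θ_1), …, d(∂φ/∂θ_N)` are
linearly independent over `ℂ` at the points of `C_φ`. -/
def IsNondegeneratePhase {n N : ℕ}
    (φ : QuadraticForm ℂ ((Fin n → ℂ) × (Fin n → ℂ) × (Fin N → ℂ))) : Prop :=
  ∀ p ∈ criticalSet φ, LinearIndependent ℂ fun j : Fin N => fderiv ℂ (fun q => phaseDθ φ q j) p

/-- The canonical relation of `φ`: the set of all pairs `((x, ξ), (y, η))` with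
`ξ = φ'_x (x, y, θ)` and `η = -φ'_y (x, y, θ)` for some `θ` with `(x, y, θ) ∈ C_φ`. -/
def canonicalRelation {n N : ℕ} (φ : QuadraticForm ℂ ((Fin n → ℂ) × (Fin n → ℂ) × (Fin N → ℂ))) :
    Set (((Fin n → ℂ) × (Fin n → ℂ)) × ((Fin n → ℂ) × (Fin n → ℂ))) :=
  (fun p => ((p.1, phaseDx φ p), (p.2.1, -phaseDy φ p))) '' criticalSet φ

/-- The phase `φ` generates the bijective complex linear map `κ : (y, η) ↦ (x, ξ)`: the graph
`{(κ ρ, ρ)}` is the canonical relation of `φ`. (Such a `κ` is automatically symplectic.) -/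
def Generates {n N : ℕ} (φ : QuadraticForm ℂ ((Fin n → ℂ) × (Fin n → ℂ) × (Fin N → ℂ)))
    (κ : ((Fin n → ℂ) × (Fin n → ℂ)) ≃ₗ[ℂ] ((Fin n → ℂ) × (Fin n → ℂ))) : Prop :=
  Set.range (fun ρ => (κ ρ, ρ)) = canonicalRelation φ

/-- The real quadratic form `(y, θ) ↦ Φ₀(y) - Im φ(0, y, θ)` on `ℂⁿ × ℂᴺ`. -/
def weightedPhaseForm {n N : ℕ} (Φ₀ : QuadraticForm ℝ (Fin n → ℂ))
    (φ : QuadraticForm ℂ ((Fin n → ℂ) × (Fin n → ℂ) × (Fin N → ℂ))) :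
    QuadraticForm ℝ ((Fin n → ℂ) × (Fin N → ℂ)) :=
  Φ₀.comp (LinearMap.fst ℝ (Fin n → ℂ) (Fin N → ℂ)) -
    Complex.imLm.compQuadraticMap ((φ.restrictScalars (S := ℝ)).comp
      (LinearMap.inr ℝ (Fin n → ℂ) ((Fin n → ℂ) × (Fin N → ℂ))))

theorem weightedPhaseForm_apply {n N : ℕ} (Φ₀ : QuadraticForm ℝ (Fin n → ℂ))
    (φ : QuadraticForm ℂ ((Fin n → ℂ) × (Fin n → ℂ) × (Fin N → ℂ)))
    (y : Fin n → ℂ) (θ : Fin N → ℂ) :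
    weightedPhaseForm Φ₀ φ (y, θ) = Φ₀ y - (φ (0, y, θ)).im := rfl

end

open QuadraticMap Module

/-! ### Derivatives of quadratic forms -/

section Derivatives

/-! Let G(x, y, θ) = Φ₀(y) - Im φ(x, y, θ) - Φ₁(x); the form in question is G on x = 0. Since Im φ
is pluriharmonic, only the weights contribute to the Levi form: it is nonnegative for G on x = 0 and
for -G on y = 0. Multiplication by i then sends negative vectors to positive ones, so either form,
once nondegenerate, has at least n + N positive squares (`finrank_le_sigPos_of_add_nonneg`).

Nondegeneracy: a radical vector gives a point of C_φ, and κ links points of Λ_Φ₀ and Λ_Φ₁, one of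
them with base point 0, hence zero; nondegeneracy of φ kills θ.

For the negative squares of G on x = 0, the equality κ(Λ_Φ₀) = Λ_Φ₁ makes the radical of G project
onto all x. Projection along the radical carries positive vectors of -G on y = 0 to positive vectors
of -G on x = 0 (`sigPos_comp_le_of_polar_eq_zero`). Both indices are thus at least n + N in
dimension 2(n + N). -/

theorem QuadraticMap.lineDeriv_eq_polar {𝕜 E : Type*} [NontriviallyNormedField 𝕜]
    [AddCommGroup E] [Module 𝕜 E] (Q : QuadraticForm 𝕜 E) (p v : E) :
    lineDeriv 𝕜 Q p v = polar Q p v := by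
  have h : ∀ t : 𝕜, Q (p + t • v) = Q p + t * polar Q p v + t * t * Q v := fun t => by
    rw [QuadraticMap.map_add Q, QuadraticMap.map_smul, polar_smul_right]
    simp only [smul_eq_mul]
    ring
  have h1 : HasDerivAt (fun t : 𝕜 => Q p + t * polar Q p v + t * t * Q v) (polar Q p v) 0 := by
    have h2 := hasDerivAt_id (0 : 𝕜)
    exact (((h2.mul_const (polar Q p v)).const_add (Q p)).add
      ((h2.mul h2).mul_const (Q v))).congr_deriv (by simp)
  rw [lineDeriv]
  simp only [h]
  exact h1.deriv

theorem QuadraticMap.lineDeriv_ofReal_eq_polar {E : Type*} [AddCommGroup E] [Module ℝ E]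
    (Q : QuadraticForm ℝ E) (p v : E) :
    lineDeriv ℝ (fun w => (Q w : ℂ)) p v = ((polar Q p v : ℝ) : ℂ) := by
  have h : ∀ t : ℝ, Q (p + t • v) = Q p + t * polar Q p v + t * t * Q v := fun t => by
    rw [QuadraticMap.map_add Q, QuadraticMap.map_smul, polar_smul_right]
    simp only [smul_eq_mul]
    ring
  have h1 : HasDerivAt (fun t : ℝ => Q p + t * polar Q p v + t * t * Q v) (polar Q p v) 0 := by
    have h2 := hasDerivAt_id (0 : ℝ)
    exact (((h2.mul_const (polar Q p v)).const_add (Q p)).add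
      ((h2.mul h2).mul_const (Q v))).congr_deriv (by simp)
  rw [lineDeriv]
  simp only [h]
  exact h1.ofReal_comp.deriv

theorem lineDeriv_linearMap {E : Type*} [AddCommGroup E] [Module ℝ E]
    (L : E →ₗ[ℝ] ℂ) (p v : E) : lineDeriv ℝ L p v = L v := by
  rw [lineDeriv]
  simp only [map_add, map_smul]
  have h := ((hasDerivAt_id (0 : ℝ)).smul_const (L v)).const_add (L p)
  simpa using h.deriv

end Derivatives

/-! ### Real quadratic forms on complex spaces -/

section Weights

variable {n : ℕ}

/-- The complex linear functional `w ↦ P(u, w) - i P(u, iw)`, where `P` is the polar form of `Φ`. -/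
noncomputable def complexPolar (Φ : QuadraticForm ℝ (Fin n → ℂ)) (u : Fin n → ℂ) : (Fin n → ℂ) →ₗ[ℂ] ℂ where
  toFun w := ((polar Φ u w : ℝ) : ℂ) - Complex.I * ((polar Φ u (Complex.I • w) : ℝ) : ℂ)
  map_add' v w := by
    simp only [smul_add, polar_add_right]
    push_cast
    ring
  map_smul' c w := by
    have h1 : c • w = c.re • w + c.im • (Complex.I • w) := by
      ext k; simp only [Pi.smul_apply, Pi.add_apply, smul_eq_mul, Complex.real_smul]
      linear_combination -(Complex.re_add_im c) * w k
    have h2 : Complex.I • c • w = c.re • (Complex.I • w) - c.im • w := by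
      ext k; simp only [Pi.smul_apply, Pi.sub_apply, smul_eq_mul, Complex.real_smul]
      linear_combination -(Complex.re_add_im c) * w k * Complex.I + c.im * w k * Complex.I_mul_I
    rw [h2, h1]
    simp only [polar_add_right, polar_sub_right, polar_smul_right, smul_eq_mul, RingHom.id_apply]
    push_cast
    conv_rhs => rw [← Complex.re_add_im c]
    linear_combination (c.im : ℂ) * ((polar Φ u (Complex.I • w) : ℝ) : ℂ) * Complex.I_mul_I

theorem complexPolar_apply (Φ : QuadraticForm ℝ (Fin n → ℂ)) (u w : Fin n → ℂ) :
    complexPolar Φ u w = ((polar Φ u w : ℝ) : ℂ) - Complex.I * ((polar Φ u (Complex.I • w) : ℝ) : ℂ) := rfl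

theorem linearMap_apply_eq_sum (f : (Fin n → ℂ) →ₗ[ℂ] ℂ) (w : Fin n → ℂ) :
    f w = ∑ k, f (Pi.single k 1) * w k := by
  conv_lhs => rw [f.pi_apply_eq_sum_univ w]
  refine Finset.sum_congr rfl fun k _ => ?_
  rw [smul_eq_mul, mul_comm]
  congr 2
  ext j
  simp [Pi.single_apply, eq_comm]

theorem dz_eq_complexPolar (Φ : QuadraticForm ℝ (Fin n → ℂ)) (k : Fin n) (z : Fin n → ℂ) :
    dz k (fun w => (Φ w : ℂ)) z = complexPolar Φ z (Pi.single k 1) / 2 := by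
  rw [dz, lineDeriv_ofReal_eq_polar, lineDeriv_ofReal_eq_polar, complexPolar_apply,
    ← Pi.single_smul, smul_eq_mul, mul_one]

/-- The covector (2/i)∂Φ is the unique complex covector ξ with dΦ = -Im(ξ·dx). -/
theorem mem_weightGraph_iff (Φ : QuadraticForm ℝ (Fin n → ℂ)) (x ξ : Fin n → ℂ) :
    (x, ξ) ∈ weightGraph Φ ↔ ∀ w, polar Φ x w = -(∑ k, ξ k * w k).im := by
  have key : ∀ ξ : Fin n → ℂ, (x, ξ) ∈ weightGraph Φ ↔
      ξ = fun k => -Complex.I * complexPolar Φ x (Pi.single k 1) := fun ξ => by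
    simp only [weightGraph, Set.mem_range, Prod.mk.injEq, exists_eq_left, dz_eq_complexPolar]
    rw [eq_comm]
    refine Eq.congr_right (funext fun k => ?_)
    rw [Complex.div_I]
    ring
  rw [key]
  constructor
  · rintro rfl w
    simp only [mul_assoc, ← Finset.mul_sum, ← linearMap_apply_eq_sum]
    simp [complexPolar_apply]
  · intro h
    ext k
    have h1 := h (Pi.single k 1)
    have h2 := h (Complex.I • Pi.single k 1)
    simp [Pi.single_apply] at h1 h2
    rw [complexPolar_apply]
    apply Complex.ext
    · simp [h2]
    · simp [h1]

theorem zero_fst_mem_weightGraph {Φ : QuadraticForm ℝ (Fin n → ℂ)} {ξ : Fin n → ℂ}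
    (h : ((0 : Fin n → ℂ), ξ) ∈ weightGraph Φ) : ξ = 0 := by
  obtain ⟨x, hx⟩ := h
  simp only [Prod.mk.injEq, dz_eq_complexPolar] at hx
  obtain ⟨rfl, rfl⟩ := hx
  ext k
  simp [complexPolar_apply]

theorem leviMatrix_apply (Φ : QuadraticForm ℝ (Fin n → ℂ)) (z : Fin n → ℂ) (j k : Fin n) :
    leviMatrix Φ z j k = (complexPolar Φ (Pi.single j 1) (Pi.single k 1) +
      Complex.I * complexPolar Φ (Complex.I • Pi.single j 1) (Pi.single k 1)) / 4 := by
  -- `dz k Φ` is real linear in the point, so differentiating it again is evaluation.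
  let L : (Fin n → ℂ) →ₗ[ℝ] ℂ :=
    { toFun := fun z => dz k (fun w => (Φ w : ℂ)) z
      map_add' := fun u v => by
        simp only [dz_eq_complexPolar, complexPolar_apply, polar_add_left]
        push_cast
        ring
      map_smul' := fun c u => by
        simp only [dz_eq_complexPolar, complexPolar_apply, polar_smul_left, smul_eq_mul,
          Complex.real_smul, RingHom.id_apply]
        push_cast
        ring }
  have hL : ∀ u, L u = complexPolar Φ u (Pi.single k 1) / 2 := fun u => dz_eq_complexPolar Φ k u
  change dzbar j L z = _
  rw [dzbar, lineDeriv_linearMap, lineDeriv_linearMap, hL, hL, ← Pi.single_smul, smul_eq_mul,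
    mul_one]
  ring

/-- Averaging Φ over v and iv removes its pluriharmonic part and leaves the Levi form. -/
theorem sum_leviMatrix (Φ : QuadraticForm ℝ (Fin n → ℂ)) (z v : Fin n → ℂ) :
    ∑ j, star (v j) * ∑ k, leviMatrix Φ z j k * v k = ((Φ v + Φ (Complex.I • v) : ℝ) : ℂ) / 2 := by
  have h1 : ∀ j, ∑ k, leviMatrix Φ z j k * v k = (complexPolar Φ (Pi.single j 1) v +
      Complex.I * complexPolar Φ (Complex.I • Pi.single j 1) v) / 4 := fun j => by
    simp only [leviMatrix_apply, linearMap_apply_eq_sum _ v, Finset.mul_sum,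
      ← Finset.sum_add_distrib, Finset.sum_div]
    exact Finset.sum_congr rfl fun k _ => by ring
  have h2 : ∀ u, complexPolar Φ u v + Complex.I * complexPolar Φ (Complex.I • u) v =
      star (complexPolar Φ v u + Complex.I * complexPolar Φ (Complex.I • v) u) := fun u => by
    simp only [complexPolar_apply, polar_comm Φ u, polar_comm Φ (Complex.I • u)]
    apply Complex.ext <;> simp <;> ring
  have h3 : ∑ j, star (v j) * ∑ k, leviMatrix Φ z j k * v k =
      star (complexPolar Φ v v + Complex.I * complexPolar Φ (Complex.I • v) v) / 4 := by
    simp only [h1]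
    rw [linearMap_apply_eq_sum (complexPolar Φ v) v,
      linearMap_apply_eq_sum (complexPolar Φ (Complex.I • v)) v, Finset.mul_sum,
      ← Finset.sum_add_distrib, star_sum, Finset.sum_div]
    refine Finset.sum_congr rfl fun k _ => ?_
    rw [h2 (Pi.single k 1)]
    simp only [star_add, star_mul']
    ring
  rw [h3]
  simp only [complexPolar_apply, polar_comm Φ (Complex.I • v) v, polar_self]
  apply Complex.ext <;> simp <;> ring

theorem IsStrictlyPlurisubharmonic.add_nonneg {Φ : QuadraticForm ℝ (Fin n → ℂ)}
    (h : IsStrictlyPlurisubharmonic Φ) (v : Fin n → ℂ) : 0 ≤ Φ v + Φ (Complex.I • v) := by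
  have h1 := (h 0).posSemidef.dotProduct_mulVec_nonneg v
  have h2 : star v ⬝ᵥ (leviMatrix Φ 0).mulVec v = ((Φ v + Φ (Complex.I • v) : ℝ) : ℂ) / 2 :=
    sum_leviMatrix Φ 0 v
  rw [h2] at h1
  have h3 := (Complex.le_def.1 h1).1
  simp at h3
  linarith

end Weights

/-! ### Signatures -/

section Signature

/-- Such an f is injective on a maximal positive subspace, because Q' vanishes at 0. -/
theorem sigPos_le_of_forall_pos {M M' : Type*} [AddCommGroup M] [Module ℝ M]
    [AddCommGroup M'] [Module ℝ M'] [FiniteDimensional ℝ M] [FiniteDimensional ℝ M']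
    {Q : QuadraticForm ℝ M} {Q' : QuadraticForm ℝ M'} (f : M →ₗ[ℝ] M')
    (h : ∀ v, 0 < Q v → 0 < Q' (f v)) : sigPos Q ≤ sigPos Q' := by
  obtain ⟨V, hV, hpos⟩ := exists_finrank_eq_sigPos_and_posDef Q
  have hV0 : ∀ v ∈ V, v ≠ 0 → 0 < Q v := fun v hv hv0 =>
    hpos ⟨v, hv⟩ (by simpa using hv0)
  have hinj : Function.Injective (f.domRestrict V) := by
    rw [← LinearMap.ker_eq_bot, LinearMap.ker_eq_bot']
    rintro ⟨v, hv⟩ hfv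
    by_contra hne
    have := h v (hV0 v hv (by simpa using hne))
    rw [LinearMap.domRestrict_apply] at hfv
    simp [hfv] at this
  rw [← hV, ← LinearMap.finrank_range_of_inj hinj]
  apply le_sigPos_of_posDef
  rintro ⟨_, ⟨v, hv⟩, rfl⟩ hne
  refine h v (hV0 v hv ?_)
  rintro rfl
  exact hne (Subtype.ext (by simp))

/-- A nondegenerate real quadratic form on a complex vector space with positive semidefinite
Levi form is positive definite on a subspace of at least half the dimension. -/
theorem finrank_le_sigPos_of_add_nonneg {E : Type*} [AddCommGroup E] [Module ℂ E] [Module ℝ E]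
    [IsScalarTower ℝ ℂ E] [FiniteDimensional ℝ E] (Q : QuadraticForm ℝ E)
    (hQ : ∀ v, 0 ≤ Q v + Q (Complex.I • v)) (hrad : ∀ v, (∀ w, polar Q v w = 0) → v = 0) :
    finrank ℝ E ≤ 2 * sigPos Q := by
  have h1 : sigNeg Q ≤ sigPos Q := by
    rw [← sigPos_neg]
    refine sigPos_le_of_forall_pos
      ((LinearMap.lsmul ℂ E Complex.I).restrictScalars ℝ) fun v hv => ?_
    have := hQ v
    rw [neg_apply] at hv
    simp only [LinearMap.coe_restrictScalars, LinearMap.lsmul_apply]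
    linarith
  have h2 : Q.radical = ⊥ := by
    rw [radical_eq_ker_polarBilin, LinearMap.ker_eq_bot']
    exact fun v hv => hrad v fun w => by simpa using LinearMap.congr_fun hv w
  have h3 := QuadraticForm.sigPos_add_sigNeg_add_radical (Q := Q)
  rw [h2, finrank_bot] at h3
  omega

/-- The radical of G surjects onto X; subtracting a radical vector with the same X-component moves
any vector into {0} × F without changing G. -/
theorem sigPos_comp_le_of_polar_eq_zero {V X F : Type*} [AddCommGroup V] [Module ℝ V]
    [AddCommGroup X] [Module ℝ X] [AddCommGroup F] [Module ℝ F]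
    [FiniteDimensional ℝ V] [FiniteDimensional ℝ F]
    (G : QuadraticForm ℝ (X × F)) (i : V →ₗ[ℝ] X × F)
    (hG : ∀ x : X, ∃ f : F, ∀ w, polar G (x, f) w = 0) :
    sigPos (G.comp i) ≤ sigPos (G.comp (LinearMap.inr ℝ X F)) := by
  have hsurj : LinearMap.range ((LinearMap.fst ℝ X F).domRestrict G.polarBilin.ker) = ⊤ := by
    rw [LinearMap.range_eq_top]
    intro x
    obtain ⟨f, hf⟩ := hG x
    refine ⟨⟨(x, f), ?_⟩, rfl⟩
    rw [LinearMap.mem_ker]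
    ext w <;> simp [hf]
  -- A linear choice of radical vector over each x.
  obtain ⟨s, hs⟩ := LinearMap.exists_rightInverse_of_surjective _ hsurj
  have hs1 : ∀ x, (s x : X × F).1 = x := fun x => LinearMap.congr_fun hs x
  have hs2 : ∀ x w, polar G (s x) w = 0 := fun x w => by
    exact LinearMap.congr_fun (LinearMap.mem_ker.1 (s x).2) w
  have hs3 : ∀ x, G (s x) = 0 := fun x => by
    have := hs2 x (s x)
    rw [polar_self] at this
    simpa using this
  refine sigPos_le_of_forall_pos (LinearMap.snd ℝ X F ∘ₗ
    (i - G.polarBilin.ker.subtype ∘ₗ s ∘ₗ LinearMap.fst ℝ X F ∘ₗ i)) fun v hv => ?_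
  have h1 : LinearMap.inr ℝ X F ((LinearMap.snd ℝ X F ∘ₗ
      (i - G.polarBilin.ker.subtype ∘ₗ s ∘ₗ LinearMap.fst ℝ X F ∘ₗ i)) v) =
      i v + -(s (i v).1 : X × F) := by
    ext <;> simp [hs1, sub_eq_add_neg]
  rw [QuadraticMap.comp_apply, h1, QuadraticMap.map_add G, QuadraticMap.map_neg, polar_neg_right,
    polar_comm, hs2, hs3]
  simpa using hv

end Signature

/-! ### Phases -/

section Phases

variable {n N : ℕ} {φ : QuadraticForm ℂ ((Fin n → ℂ) × (Fin n → ℂ) × (Fin N → ℂ))}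

theorem polar_phase (p : (Fin n → ℂ) × (Fin n → ℂ) × (Fin N → ℂ)) (u v : Fin n → ℂ)
    (t : Fin N → ℂ) :
    polar φ p (u, v, t) = ∑ k, phaseDx φ p k * u k + ∑ k, phaseDy φ p k * v k +
      ∑ j, phaseDθ φ p j * t j := by
  have h : (u, v, t) = (u, 0, 0) + (0, v, 0) + (0, 0, t) := by simp
  simp only [phaseDx, phaseDy, phaseDθ, lineDeriv_eq_polar]
  rw [h, polar_add_right, polar_add_right]
  congr 1
  · congr 1
    · exact linearMap_apply_eq_sum (polarBilin φ p ∘ₗ LinearMap.inl ℂ _ _) u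
    · exact linearMap_apply_eq_sum
        (polarBilin φ p ∘ₗ LinearMap.inr ℂ _ _ ∘ₗ LinearMap.inl ℂ _ _) v
  · exact linearMap_apply_eq_sum
      (polarBilin φ p ∘ₗ LinearMap.inr ℂ _ _ ∘ₗ LinearMap.inr ℂ _ _) t

theorem IsNondegeneratePhase.eq_zero_of_polar_eq_zero (hφ : IsNondegeneratePhase φ)
    {θ : Fin N → ℂ} (h : ∀ w, polar φ (0, 0, θ) w = 0) : θ = 0 := by
  have h0 : (0 : (Fin n → ℂ) × (Fin n → ℂ) × (Fin N → ℂ)) ∈ criticalSet φ := by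
    simp only [criticalSet, Set.mem_ofPred_eq]
    ext j
    simp [phaseDθ, lineDeriv_eq_polar]
  have hfd : ∀ (j : Fin N) (q : (Fin n → ℂ) × (Fin n → ℂ) × (Fin N → ℂ)),
      fderiv ℂ (fun q => phaseDθ φ q j) 0 q = phaseDθ φ q j := fun j q => by
    have : (fun q => phaseDθ φ q j) =
        (LinearMap.toContinuousLinearMap ((polarBilin φ).flip (0, 0, Pi.single j 1))) := by
      ext q
      simp [phaseDθ, lineDeriv_eq_polar]
    rw [this, ContinuousLinearMap.fderiv]
    exact (congrFun this q).symm
  -- By symmetry of the polar form, the components of θ are the coefficients of a linear relation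
  -- among the d(∂φ/∂θ_j).
  have hli := Fintype.linearIndependent_iff.1 (hφ 0 h0) θ ?_
  · exact funext hli
  · refine ContinuousLinearMap.ext fun q => ?_
    simp only [sum_apply, smul_apply, hfd, smul_eq_mul,
      zero_apply]
    have h1 := h q
    rw [polar_comm] at h1
    have h2 := polar_phase (φ := φ) q 0 0 θ
    simp only [h1, Pi.zero_apply, mul_zero, Finset.sum_const_zero, zero_add] at h2
    rw [h2]
    exact Finset.sum_congr rfl fun j _ => mul_comm _ _

theorem eq_zero_of_im_sum_eq_zero {m : ℕ} {a : Fin m → ℂ}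
    (h : ∀ t : Fin m → ℂ, (∑ j, a j * t j).im = 0) : a = 0 := by
  ext j
  have h1 := h (Pi.single j 1)
  have h2 := h (Pi.single j Complex.I)
  simp [Pi.single_apply] at h1 h2
  exact Complex.ext h2 h1

/-- The real quadratic form `Φ₀(y) - Im φ(x, y, θ) - Φ₁(x)`. -/
noncomputable def fullPhaseForm (Φ₀ Φ₁ : QuadraticForm ℝ (Fin n → ℂ))
    (φ : QuadraticForm ℂ ((Fin n → ℂ) × (Fin n → ℂ) × (Fin N → ℂ))) :
    QuadraticForm ℝ ((Fin n → ℂ) × (Fin n → ℂ) × (Fin N → ℂ)) :=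
  Φ₀.comp (LinearMap.fst ℝ _ _ ∘ₗ LinearMap.snd ℝ _ _) -
    Complex.imLm.compQuadraticMap (φ.restrictScalars (S := ℝ)) - Φ₁.comp (LinearMap.fst ℝ _ _)

variable {Φ₀ Φ₁ : QuadraticForm ℝ (Fin n → ℂ)}

theorem fullPhaseForm_apply (p : (Fin n → ℂ) × (Fin n → ℂ) × (Fin N → ℂ)) :
    fullPhaseForm Φ₀ Φ₁ φ p = Φ₀ p.2.1 - (φ p).im - Φ₁ p.1 := rfl

/-- Grouped so that p is radical exactly when (y, -φ'_y) ∈ Λ_Φ₀, (x, φ'_x) ∈ Λ_Φ₁ and φ'_θ = 0. -/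
theorem polar_fullPhaseForm (p : (Fin n → ℂ) × (Fin n → ℂ) × (Fin N → ℂ)) (u v : Fin n → ℂ)
    (t : Fin N → ℂ) :
    polar (fullPhaseForm Φ₀ Φ₁ φ) p (u, v, t) =
      (polar Φ₀ p.2.1 v - (∑ k, phaseDy φ p k * v k).im) -
      (polar Φ₁ p.1 u + (∑ k, phaseDx φ p k * u k).im) - (∑ j, phaseDθ φ p j * t j).im := by
  have h := congrArg Complex.im (polar_phase (φ := φ) p u v t)
  simp only [polar, Complex.sub_im, Complex.add_im] at h
  simp only [polar, fullPhaseForm_apply, Prod.fst_add, Prod.snd_add]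
  linarith

theorem fullPhaseForm_comp_inr :
    (fullPhaseForm Φ₀ Φ₁ φ).comp (LinearMap.inr ℝ _ _) = weightedPhaseForm Φ₀ φ := by
  ext ⟨y, θ⟩
  simp [fullPhaseForm_apply, weightedPhaseForm_apply]

/-- Im φ cancels because φ(ip) = -φ(p). -/
theorem fullPhaseForm_add_smul_I (p : (Fin n → ℂ) × (Fin n → ℂ) × (Fin N → ℂ)) :
    fullPhaseForm Φ₀ Φ₁ φ p + fullPhaseForm Φ₀ Φ₁ φ (Complex.I • p) =
      (Φ₀ p.2.1 + Φ₀ (Complex.I • p.2.1)) - (Φ₁ p.1 + Φ₁ (Complex.I • p.1)) := by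
  simp only [fullPhaseForm_apply, QuadraticMap.map_smul, Prod.smul_fst, Prod.smul_snd,
    Complex.I_mul_I, smul_eq_mul, neg_mul, one_mul, Complex.neg_im]
  ring

/-! ### Radical and nondegeneracy via the canonical transformation -/

variable {κ : ((Fin n → ℂ) × (Fin n → ℂ)) ≃ₗ[ℂ] ((Fin n → ℂ) × (Fin n → ℂ))}

theorem Generates.apply_eq (hκ : Generates φ κ)
    {p : (Fin n → ℂ) × (Fin n → ℂ) × (Fin N → ℂ)} (hp : phaseDθ φ p = 0) :
    κ (p.2.1, -phaseDy φ p) = (p.1, phaseDx φ p) := by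
  have h : ((p.1, phaseDx φ p), (p.2.1, -phaseDy φ p)) ∈ canonicalRelation φ := ⟨p, hp, rfl⟩
  rw [← hκ] at h
  obtain ⟨ρ, hρ⟩ := h
  rw [Prod.mk.injEq] at hρ
  rw [← hρ.2, hρ.1]

/-- A critical point of `φ` in `θ` over `(0, 0)` in the base, with vanishing covectors, is `0`. -/
theorem IsNondegeneratePhase.eq_zero (hφ : IsNondegeneratePhase φ)
    {p : (Fin n → ℂ) × (Fin n → ℂ) × (Fin N → ℂ)} (hθ : phaseDθ φ p = 0)
    (h1 : (p.1, phaseDx φ p) = 0) (h2 : (p.2.1, -phaseDy φ p) = 0) : p = 0 := by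
  obtain ⟨x, y, θ⟩ := p
  simp only [Prod.mk_eq_zero, neg_eq_zero] at h1 h2
  obtain ⟨rfl, hx⟩ := h1
  obtain ⟨rfl, hy⟩ := h2
  have : θ = 0 := hφ.eq_zero_of_polar_eq_zero fun ⟨u, v, t⟩ => by
    rw [polar_phase, hx, hy, hθ]
    simp
  simp [this]

/-- The point of Λ_Φ₁ over x is κ of a point of Λ_Φ₀; the canonical relation supplies y and θ. -/
theorem exists_polar_fullPhaseForm_eq_zero (hκ : Generates φ κ)
    (hΛ : κ '' weightGraph Φ₀ = weightGraph Φ₁) (x : Fin n → ℂ) :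
    ∃ f : (Fin n → ℂ) × (Fin N → ℂ), ∀ w, polar (fullPhaseForm Φ₀ Φ₁ φ) (x, f) w = 0 := by
  obtain ⟨ξ, hξ⟩ : ∃ ξ, (x, ξ) ∈ weightGraph Φ₁ := ⟨_, x, rfl⟩
  have hξ' := hξ
  rw [← hΛ] at hξ'
  obtain ⟨ρ, hρ, hρx⟩ := hξ'
  have hρ' : (κ ρ, ρ) ∈ canonicalRelation φ := hκ ▸ Set.mem_range_self ρ
  obtain ⟨⟨x', y, θ⟩, hθ, hp⟩ := hρ'
  rw [hρx] at hp
  simp only [Prod.mk.injEq] at hp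
  obtain ⟨⟨rfl, rfl⟩, rfl⟩ := hp
  refine ⟨(y, θ), fun ⟨u, v, t⟩ => ?_⟩
  have hθ' : phaseDθ φ (x', y, θ) = 0 := hθ
  rw [polar_fullPhaseForm, hθ', (mem_weightGraph_iff _ _ _).1 hξ u,
    (mem_weightGraph_iff _ _ _).1 hρ v]
  simp

theorem weightedPhaseForm_nondegenerate (hφ : IsNondegeneratePhase φ) (hκ : Generates φ κ)
    (hΛ : κ '' weightGraph Φ₀ = weightGraph Φ₁) (q : (Fin n → ℂ) × (Fin N → ℂ))
    (hq : ∀ w, polar (weightedPhaseForm Φ₀ φ) q w = 0) : q = 0 := by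
  have hpol : ∀ v t, polar (fullPhaseForm Φ₀ Φ₁ φ) (0, q) (0, v, t) = 0 := fun v t => by
    rw [← hq (v, t), ← fullPhaseForm_comp_inr (Φ₁ := Φ₁)]
    simp [polar]
  simp only [polar_fullPhaseForm] at hpol
  have hθ : phaseDθ φ (0, q) = 0 := eq_zero_of_im_sum_eq_zero fun t => by
    simpa using hpol 0 t
  have hy : (q.1, -phaseDy φ (0, q)) ∈ weightGraph Φ₀ :=
    (mem_weightGraph_iff _ _ _).2 fun v => by
      have := hpol v 0
      simp [-Complex.mul_im, -Complex.im_sum] at this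
      simp only [Pi.neg_apply, neg_mul, Finset.sum_neg_distrib, Complex.neg_im]
      linarith
  have hκp := hκ.apply_eq hθ
  have hx : (0, phaseDx φ (0, q)) ∈ weightGraph Φ₁ := hΛ ▸ ⟨_, hy, hκp⟩
  have h1 : ((0 : Fin n → ℂ), phaseDx φ (0, q)) = 0 := by
    rw [zero_fst_mem_weightGraph hx]; rfl
  have h2 := hφ.eq_zero hθ h1 (by rwa [h1, κ.map_eq_zero_iff] at hκp)
  exact (Prod.mk_eq_zero.1 h2).2

/-- The inclusion `(x, θ) ↦ (x, 0, θ)`. -/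
def zeroMiddle (n N : ℕ) :
    (Fin n → ℂ) × (Fin N → ℂ) →ₗ[ℂ] (Fin n → ℂ) × (Fin n → ℂ) × (Fin N → ℂ) :=
  LinearMap.prodMap LinearMap.id (LinearMap.inr ℂ _ _)

theorem zeroMiddle_apply (q : (Fin n → ℂ) × (Fin N → ℂ)) :
    zeroMiddle n N q = (q.1, 0, q.2) := rfl

/-- The mirror argument, pulling a point of Λ_Φ₁ back by κ to the point of Λ_Φ₀ over y = 0. -/
theorem fullPhaseForm_comp_zeroMiddle_nondegenerate (hφ : IsNondegeneratePhase φ)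
    (hκ : Generates φ κ) (hΛ : κ '' weightGraph Φ₀ = weightGraph Φ₁)
    (q : (Fin n → ℂ) × (Fin N → ℂ))
    (hq : ∀ w, polar (fullPhaseForm Φ₀ Φ₁ φ) (zeroMiddle n N q) (zeroMiddle n N w) = 0) :
    q = 0 := by
  have hpol : ∀ u t, polar (fullPhaseForm Φ₀ Φ₁ φ) (q.1, 0, q.2) (u, 0, t) = 0 :=
    fun u t => hq (u, t)
  simp only [polar_fullPhaseForm] at hpol
  have hθ : phaseDθ φ (q.1, 0, q.2) = 0 := eq_zero_of_im_sum_eq_zero fun t => by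
    simpa using hpol 0 t
  have hx : (q.1, phaseDx φ (q.1, 0, q.2)) ∈ weightGraph Φ₁ :=
    (mem_weightGraph_iff _ _ _).2 fun u => by
      have := hpol u 0
      simp [-Complex.mul_im, -Complex.im_sum] at this
      linarith
  have hκp := hκ.apply_eq hθ
  have hy : (0, -phaseDy φ (q.1, 0, q.2)) ∈ weightGraph Φ₀ := by
    rw [← hΛ] at hx
    obtain ⟨ρ, hρ, h⟩ := hx
    rw [← hκp] at h
    rwa [κ.injective h] at hρ
  have h1 : ((0 : Fin n → ℂ), -phaseDy φ (q.1, 0, q.2)) = 0 := by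
    rw [zero_fst_mem_weightGraph hy]; rfl
  have h2 := hφ.eq_zero hθ (by rw [← hκp, h1, map_zero]) h1
  simp only [Prod.mk_eq_zero] at h2
  exact Prod.ext h2.1 h2.2.2

end Phases

/-! ### The signature count -/

theorem propositionB2 (n N : ℕ)
    (φ : QuadraticForm ℂ ((Fin n → ℂ) × (Fin n → ℂ) × (Fin N → ℂ)))
    (hφ : IsNondegeneratePhase φ)
    (κ : ((Fin n → ℂ) × (Fin n → ℂ)) ≃ₗ[ℂ] ((Fin n → ℂ) × (Fin n → ℂ)))
    (hκ : Generates φ κ)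
    (Φ₀ Φ₁ : QuadraticForm ℝ (Fin n → ℂ))
    (hΦ₀ : IsStrictlyPlurisubharmonic Φ₀)
    (hΦ₁ : IsStrictlyPlurisubharmonic Φ₁)
    (hΛ : κ '' weightGraph Φ₀ = weightGraph Φ₁) :
    sigPos (weightedPhaseForm Φ₀ φ) = n + N ∧
      sigNeg (weightedPhaseForm Φ₀ φ) = n + N := by
  have hdim : finrank ℝ ((Fin n → ℂ) × (Fin N → ℂ)) = 2 * (n + N) := by
    rw [finrank_real_of_complex]
    simp
  have hpos : finrank ℝ ((Fin n → ℂ) × (Fin N → ℂ)) ≤ 2 * sigPos (weightedPhaseForm Φ₀ φ) := by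
    refine finrank_le_sigPos_of_add_nonneg _ (fun v => ?_)
      (weightedPhaseForm_nondegenerate hφ hκ hΛ)
    have h := fullPhaseForm_add_smul_I (φ := φ) (Φ₀ := Φ₀) (Φ₁ := Φ₁) (0, v)
    rw [← fullPhaseForm_comp_inr (Φ₁ := Φ₁)]
    have h0 := hΦ₀.add_nonneg v.1
    simp only [Prod.smul_mk, smul_zero, QuadraticMap.map_zero] at h
    simp only [QuadraticMap.comp_apply, LinearMap.inr_apply]
    linarith
  have hneg : finrank ℝ ((Fin n → ℂ) × (Fin N → ℂ)) ≤ 2 * sigNeg (weightedPhaseForm Φ₀ φ) := by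
    have h1 : finrank ℝ ((Fin n → ℂ) × (Fin N → ℂ)) ≤
        2 * sigPos ((-fullPhaseForm Φ₀ Φ₁ φ).comp ((zeroMiddle n N).restrictScalars ℝ)) := by
      refine finrank_le_sigPos_of_add_nonneg _ (fun v => ?_) fun q hq =>
        fullPhaseForm_comp_zeroMiddle_nondegenerate hφ hκ hΛ q fun w => ?_
      · have h := fullPhaseForm_add_smul_I (φ := φ) (Φ₀ := Φ₀) (Φ₁ := Φ₁) (zeroMiddle n N v)
        have h0 := hΦ₁.add_nonneg v.1
        simp only [zeroMiddle_apply, smul_zero, QuadraticMap.map_zero] at h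
        simp only [QuadraticMap.comp_apply, LinearMap.coe_restrictScalars, map_smul,
          neg_apply, zeroMiddle_apply]
        linarith
      · have h := hq w
        simp only [polar, QuadraticMap.comp_apply, LinearMap.coe_restrictScalars, map_add,
          neg_apply] at h
        simp only [polar]
        linarith
    -- Transfers the positive squares of -G from y = 0 to x = 0.
    have h2 := sigPos_comp_le_of_polar_eq_zero (-fullPhaseForm Φ₀ Φ₁ φ)
      ((zeroMiddle n N).restrictScalars ℝ) fun x => by
        obtain ⟨f, hf⟩ := exists_polar_fullPhaseForm_eq_zero hκ hΛ x
        refine ⟨f, fun w => ?_⟩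
        have h := hf w
        simp only [polar] at h
        simp only [polar, neg_apply]
        linarith
    have h3 : (-fullPhaseForm Φ₀ Φ₁ φ).comp (LinearMap.inr ℝ _ _) = -weightedPhaseForm Φ₀ φ := by
      rw [← fullPhaseForm_comp_inr (Φ₁ := Φ₁)]
      rfl
    rw [h3, sigPos_neg] at h2
    omega
  have hsum := QuadraticForm.sigPos_add_sigNeg_add_radical (Q := weightedPhaseForm Φ₀ φ)
  omega
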